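/- For $y,y'\in\mathbb{R}$ let $|y-y'|_{\mathbb{T}}=\min_{k\in\mathbb{Z}}|y-y'-k|$ be the wrap-around distance. An exponential sum is a function $f(x)=\sum_{y\in Y^f}c^f_y e^{2\pi i yx}$ with a finite set of frequencies $Y^f\subset[0,1)$ and coefficients $c^f_y\in\mathbb{C}\setminus\{0\}$. For $r>0$ let $\mathcal{S}(r)$ be the set of exponential sums $f$ with $|y-y'|_{\mathbb{T}}\ge r$ for all distinct $y,y'\in Y^f$. Let $N\in\mathbb{N}$, $q\ge\frac{3}{2N+2}$, and let $f,g\in\mathcal{S}(2q)$ be fixed (deterministic) exponential sums all of whose coefficients have modulus at least $c_{\min}>0$. Put $\mathbf{f}=(f(k))_{k=-N,\dots,N}$ and $\mathbf{g}=(g(k))_{k=-N,\dots,N}$ in $\mathbb{C}^{2N+1}$, and let $\boldsymbol\eta=(\eta_k)_{k=-N,\dots,N}$ with $\eta_k=X_{k,1}+iX_{k,2}$, where the $X_{k,j}$ are independent Gaussian random variables with mean $0$ and variance $\sigma^2$, $\sigma\ge 0$. Let $\delta\in(0,1)$ and $$E=\left(\left|\,\|\mathbf{f}+\boldsymbol\eta-\mathbf{g}\|_2^2-2(2N+1)\sigma^2\right|^{1/2}+(2+\sqrt2)\,\sigma\,(2N+1)^{(1+\delta)/4}\right)^2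 .$$ Then, with probability at least $$1-e^{-(2N+1)^{(1+\delta)/2}}-2e^{-(2N+1)^{\delta}/8},$$ the following implication holds. If $E\le\frac{4N+4}{3}c_{\min}^2$, then for every $y\in Y^f$ there is exactly one $n(y)\in Y^g$ with $|y-n(y)|_{\mathbb{T}}<\frac{3}{2N+2}$, for every $y'\in Y^g$ there is exactly one $y\in Y^f$ with $|y-y'|_{\mathbb{T}}<\frac{3}{2N+2}$ (so $n:Y^f\to Y^g$ is a bijection), and $$\sum_{y\in Y^f}\left[\frac{N+1}{3}\left|c^f_y-c^g_{n(y)}\right|^2+\frac{2\pi^2(N+1)^3}{3^5}\,|y-n(y)|_{\mathbb{T}}^2\left|c^f_y+c^g_{n(y)}\right|^2\right]\le E .$$ -/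

import Mathlib

open MeasureTheory ProbabilityTheory
open scoped NNReal

noncomputable section

/-- The wrap-around distance of two real numbers, the infimum over all integers `k`
of `|y - y' - k|`; it is attained by `wrapDist_eq`. -/
def wrapDist (y y' : ℝ) : ℝ := ⨅ k : ℤ, |y - y' - (k : ℝ)|

/-- The infimum defining the wrap-around distance is a minimum, attained at the nearest integer. -/
theorem wrapDist_eq (y y' : ℝ) : wrapDist y y' = |y - y' - (round (y - y') : ℝ)| := by
  apply le_antisymm
  · exact ciInf_le ⟨0, by rintro _ ⟨k, rfl⟩; exact abs_nonneg _⟩ (round (y - y'))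
  · exact le_ciInf fun k => round_le (y - y') k

/-- An exponential sum with finitely many frequencies in `[0,1)`. The frequencies are the points of
the support of `coeff`, so that the coefficient of every frequency is nonzero. -/
structure ExpSum where
  /-- the coefficient of each frequency, and zero elsewhere -/
  coeff : ℝ →₀ ℂ
  /-- all frequencies lie in `[0,1)` -/
  freq_mem : ∀ y ∈ coeff.support, y ∈ Set.Ico (0 : ℝ) 1

namespace ExpSum

/-- The set of frequencies of an exponential sum. -/
def freqs (f : ExpSum) : Finset ℝ := f.coeff.support

/-- The value of the exponential sum at a real point. -/
def eval (f : ExpSum) (x : ℝ) : ℂ :=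
  ∑ y ∈ f.freqs, f.coeff y * Complex.exp (2 * (Real.pi : ℂ) * Complex.I * (y : ℂ) * (x : ℂ))

/-- Distinct frequencies have wrap-around distance at least `q`. A sum with at most one
frequency satisfies this for every `q` (a minimum over the empty set being infinite). -/
def WellSeparated (f : ExpSum) (q : ℝ) : Prop :=
  ∀ y ∈ f.freqs, ∀ y' ∈ f.freqs, y ≠ y' → q ≤ wrapDist y y'

end ExpSum

/-- The sampling points `-N, …, N`. -/
abbrev SampleIdx (N : ℕ) : Type := ↥(Finset.Icc (-(N : ℤ)) (N : ℤ))

/-- The vector of the samples of an exponential sum at `-N, …, N`. -/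
def sampleVec (N : ℕ) (f : ExpSum) : EuclideanSpace ℂ (SampleIdx N) :=
  WithLp.toLp 2 fun k => f.eval ((k : ℤ) : ℝ)

/-- The complex noise vector with real parts `X k 0` and imaginary parts `X k 1`. -/
def noiseVec {Ω : Type*} (N : ℕ) (X : SampleIdx N → Fin 2 → Ω → ℝ) (ω : Ω) :
    EuclideanSpace ℂ (SampleIdx N) :=
  WithLp.toLp 2 fun k => (X k 0 ω : ℂ) + Complex.I * (X k 1 ω : ℂ)

/-- The error estimator as a function of the observed residual `v`, which is the noisy sample
vector minus the sample vector of the candidate. -/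
def errorEstimator (N : ℕ) (σ δ : ℝ) (v : EuclideanSpace ℂ (SampleIdx N)) : ℝ :=
  (Real.sqrt |‖v‖ ^ 2 - 2 * (2 * (N : ℝ) + 1) * σ ^ 2|
    + (2 + Real.sqrt 2) * σ * (2 * (N : ℝ) + 1) ^ ((1 + δ) / 4)) ^ 2

end

/-!
The samples `h = f - g` at `-N, …, N` are bounded from below by a localized quadratic form in the
coefficients, and the noise is controlled by two Gaussian tail bounds.

**Lower bound for the samples.** Let `r = 3 / (2 N + 2)`. The even function that equals
`2 (1 - t) cos (π t) + 2 / (3 π) sin (3 π t)` on `[0, 1]` (`profile`) and vanishes beyond has a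
Fourier transform `profileFT` that is at most one on the real line (`profileFT_le_one`) and
nonpositive outside `(-3/2, 3/2)` (`profileFT_nonpos`). Rescaled to the support `[-r, r]` and
periodized, it gives a kernel on the circle whose `k`-th Fourier coefficient `profileFT (k r)` is at
most the indicator of `|k| ≤ N`. By its Fourier series, `∑_{|k| ≤ N} ‖h k‖²` is at least the
quadratic form of the kernel in the coefficients of `h` (`re_sum_locKernel_le`). Since `f` and `g`
are separated by `2 r`, this form splits into pairs of a frequency of `f` and a frequency of `g` at
distance less than `r`, and isolated frequencies (`ExpSum.sum_clusters_le`). An isolated frequency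
contributes `2 / r = (4 N + 4) / 3` times its squared coefficient. A pair at distance `d` contributes
`(A + B) / 2 ‖c - c'‖² + (A - B) / 2 ‖c + c'‖²`, where `A` and `B` are the values of the kernel at
`0` and `d`, and elementary bounds for the profile turn this into the summand of the claim
(`ExpSum.le_pairForm`). A small norm of the samples therefore excludes isolated frequencies
(`ExpSum.exists_wrapDist_lt`).

**Noise.** With `H = ‖h‖` one has `‖h + η‖² = H² + 2 L + ‖η‖²`, where `L` is a centred Gaussian linear
form of variance `σ² H²`. The lower tails of `L` (`measureReal_linear_le`) and of `‖η‖²`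
(`measureReal_sum_sq_le`) suffice, and completing the square gives `H² ≤ E` outside the two
exceptional events (`prob_norm_sq_le_errorEstimator`).

The matching argument uses `r ≤ 1/2`, that is, `N ≥ 2`. This is no loss: for `N ≤ 2` the asserted
lower bound for the probability is not positive (`prob_bound_nonpos`).
-/

/-! ### The profile of the localizing kernel -/

/-- The localizing kernel as a function of the rescaled distance `t ∈ [0, 1]`. -/
noncomputable def profile (t : ℝ) : ℝ :=
  2 * (1 - t) * Real.cos (Real.pi * t) + 2 / (3 * Real.pi) * Real.sin (3 * Real.pi * t)

/-- The cosine transform of `profile`, that is, the Fourier transform of its even extension by zero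
from `[0, 1]` to the real line. -/
noncomputable def profileFT (x : ℝ) : ℝ :=
  2 * ∫ t in (0 : ℝ)..1, profile t * Real.cos (2 * Real.pi * x * t)

@[fun_prop]
theorem continuous_profile : Continuous profile := by
  unfold profile; fun_prop

theorem profile_zero : profile 0 = 2 := by simp [profile]

theorem profile_one : profile 1 = 0 := by
  have : Real.sin (3 * Real.pi) = 0 := by simpa using Real.sin_nat_mul_pi 3
  simp [profile, this]

theorem two_div_three_mul_pi_le : 2 / (3 * Real.pi) ≤ 1 / 4 := by
  have := Real.pi_gt_three
  rw [div_le_div_iff₀ (by positivity) (by norm_num)]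
  linarith

theorem neg_one_le_profile {t : ℝ} (h0 : 0 ≤ t) (h1 : t ≤ 1) : -1 ≤ profile t := by
  have hpi := Real.pi_pos
  have hs : -(1 / 4) ≤ 2 / (3 * Real.pi) * Real.sin (3 * Real.pi * t) := by
    have h2 := two_div_three_mul_pi_le
    have h3 : 0 ≤ 2 / (3 * Real.pi) := by positivity
    nlinarith [Real.neg_one_le_sin (3 * Real.pi * t)]
  have hc : -(1 / 2) ≤ 2 * (1 - t) * Real.cos (Real.pi * t) := by
    rcases le_total t (1 / 2) with h | h
    · have : 0 ≤ Real.cos (Real.pi * t) :=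
        Real.cos_nonneg_of_mem_Icc ⟨by nlinarith, by nlinarith⟩
      have : 0 ≤ 2 * (1 - t) * Real.cos (Real.pi * t) :=
        mul_nonneg (by linarith) this
      linarith
    -- `cos (π t) = -sin (π (t - 1/2)) ≥ -π (t - 1/2)`, and `(1 - t) (t - 1/2) ≤ 1/16`
    · have h2 : -(Real.pi * (t - 1 / 2)) ≤ Real.cos (Real.pi * t) := by
        have h3 : Real.cos (Real.pi * t) = -Real.sin (Real.pi * (t - 1 / 2)) := by
          rw [← Real.cos_add_pi_div_two]; congr 1; ring
        rw [h3]
        exact neg_le_neg (Real.sin_le (mul_nonneg hpi.le (by linarith)))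
      have h4 : (1 - t) * (t - 1 / 2) ≤ 1 / 16 := by nlinarith [sq_nonneg (t - 3 / 4)]
      have h5 : (1 - t) * -(Real.pi * (t - 1 / 2)) ≤ (1 - t) * Real.cos (Real.pi * t) :=
        mul_le_mul_of_nonneg_left h2 (by linarith)
      nlinarith [Real.pi_lt_d2]
  unfold profile
  linarith

theorem profile_le {t : ℝ} (h0 : 0 ≤ t) (h1 : t ≤ 1) :
    profile t ≤ 2 - Real.pi ^ 2 / 18 * t ^ 2 := by
  have hpi := Real.pi_pos
  have hpi2 : Real.pi ^ 2 / 18 ≤ 1 := by nlinarith [Real.pi_lt_d2, Real.pi_gt_three]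
  have ht2 : 0 ≤ t ^ 2 := by positivity
  have hkey : Real.pi ^ 2 / 18 * t ^ 2 ≤ 1 * t ^ 2 := mul_le_mul_of_nonneg_right hpi2 ht2
  have hq : 0 < 2 / (3 * Real.pi) := by positivity
  unfold profile
  rcases le_total t (1 / 2) with h | h
  -- `sin (3 π t) ≤ 3 π t` alone gives the bound `2`; the gain comes from the cosine
  · have hc : Real.cos (Real.pi * t) ≤ 1 - 2 * t ^ 2 := by
      have := Real.cos_le_one_sub_mul_cos_sq (x := Real.pi * t)
        (by rw [abs_of_nonneg (by positivity)]; nlinarith)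
      refine this.trans_eq ?_
      field_simp
    have hs : 2 / (3 * Real.pi) * Real.sin (3 * Real.pi * t) ≤ 2 * t := by
      have := mul_le_mul_of_nonneg_left
        (Real.sin_le (x := 3 * Real.pi * t) (by positivity)) hq.le
      refine this.trans_eq ?_
      field_simp
    have h3 : (1 - t) * Real.cos (Real.pi * t) ≤ (1 - t) * (1 - 2 * t ^ 2) :=
      mul_le_mul_of_nonneg_left hc (by linarith)
    nlinarith [mul_nonneg ht2 (sub_nonneg.2 h)]
  · have hc : Real.cos (Real.pi * t) ≤ 0 :=
      Real.cos_nonpos_of_pi_div_two_le_of_le (by nlinarith) (by nlinarith)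
    have h3 : 2 * (1 - t) * Real.cos (Real.pi * t) ≤ 0 :=
      mul_nonpos_of_nonneg_of_nonpos (by linarith) hc
    have hs : 2 / (3 * Real.pi) * Real.sin (3 * Real.pi * t) ≤ 1 / 4 := by
      nlinarith [Real.sin_le_one (3 * Real.pi * t), two_div_three_mul_pi_le]
    nlinarith

/-! ### The cosine transform of the profile -/

theorem integral_one_sub_mul_cos {a : ℝ} (ha : a ≠ 0) :
    ∫ t in (0 : ℝ)..1, (1 - t) * Real.cos (a * t) = (1 - Real.cos a) / a ^ 2 := by
  have hd : ∀ t ∈ Set.uIcc (0 : ℝ) 1,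
      HasDerivAt (fun t => (1 - t) * (Real.sin (a * t) / a) - Real.cos (a * t) / a ^ 2)
        ((1 - t) * Real.cos (a * t)) t := by
    intro t _
    have h1 : HasDerivAt (fun t => a * t) a t := by
      simpa using (hasDerivAt_id t).const_mul a
    have h2 := (((hasDerivAt_id t).const_sub 1).mul (h1.sin.div_const a)).sub
      (h1.cos.div_const (a ^ 2))
    refine h2.congr_deriv ?_
    simp only [id]
    field_simp
    ring
  rw [intervalIntegral.integral_eq_sub_of_hasDerivAt hd
    (Continuous.intervalIntegrable (by fun_prop) _ _)]
  simp
  ring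

theorem integral_sin_const_mul {a : ℝ} (ha : a ≠ 0) :
    ∫ t in (0 : ℝ)..1, Real.sin (a * t) = (1 - Real.cos a) / a := by
  rw [intervalIntegral.integral_comp_mul_left (fun t => Real.sin t) ha]
  simp
  ring

theorem profileFT_eq {x : ℝ} (h1 : 2 * x + 1 ≠ 0) (h2 : 2 * x - 1 ≠ 0) (h3 : 3 + 2 * x ≠ 0)
    (h4 : 3 - 2 * x ≠ 0) :
    profileFT x = 2 * (1 + Real.cos (2 * Real.pi * x)) / Real.pi ^ 2 *
      (1 / (2 * x + 1) ^ 2 + 1 / (2 * x - 1) ^ 2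
        + 1 / 3 * (1 / (3 + 2 * x) + 1 / (3 - 2 * x))) := by
  have hpi := Real.pi_ne_zero
  have hsplit : ∀ t : ℝ, profile t * Real.cos (2 * Real.pi * x * t) =
      ((1 - t) * Real.cos (((2 * x + 1) * Real.pi) * t)
        + (1 - t) * Real.cos (((2 * x - 1) * Real.pi) * t))
      + (1 / (3 * Real.pi) * Real.sin (((3 + 2 * x) * Real.pi) * t)
        + 1 / (3 * Real.pi) * Real.sin (((3 - 2 * x) * Real.pi) * t)) := by
    intro t
    have e1 : ((2 * x + 1) * Real.pi) * t = 2 * Real.pi * x * t + Real.pi * t := by ring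
    have e2 : ((2 * x - 1) * Real.pi) * t = 2 * Real.pi * x * t - Real.pi * t := by ring
    have e3 : ((3 + 2 * x) * Real.pi) * t = 3 * Real.pi * t + 2 * Real.pi * x * t := by ring
    have e4 : ((3 - 2 * x) * Real.pi) * t = 3 * Real.pi * t - 2 * Real.pi * x * t := by ring
    rw [e1, e2, e3, e4, Real.cos_add, Real.cos_sub, Real.sin_add, Real.sin_sub, profile]
    ring
  have c1 : Real.cos ((2 * x + 1) * Real.pi) = -Real.cos (2 * Real.pi * x) := by
    rw [← Real.cos_add_pi]; congr 1; ring
  have c2 : Real.cos ((2 * x - 1) * Real.pi) = -Real.cos (2 * Real.pi * x) := by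
    rw [← Real.cos_sub_pi]; congr 1; ring
  have c3 : Real.cos ((3 + 2 * x) * Real.pi) = -Real.cos (2 * Real.pi * x) := by
    rw [← Real.cos_add_pi, ← Real.cos_add_two_pi (2 * Real.pi * x + Real.pi)]; congr 1; ring
  have c4 : Real.cos ((3 - 2 * x) * Real.pi) = -Real.cos (2 * Real.pi * x) := by
    rw [← Real.cos_neg (2 * Real.pi * x), ← Real.cos_add_pi,
      ← Real.cos_add_two_pi (-(2 * Real.pi * x) + Real.pi)]
    congr 1; ring
  unfold profileFT
  simp_rw [hsplit]
  rw [intervalIntegral.integral_add, intervalIntegral.integral_add,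
    intervalIntegral.integral_add, intervalIntegral.integral_const_mul,
    intervalIntegral.integral_const_mul,
    integral_one_sub_mul_cos (mul_ne_zero h1 hpi), integral_one_sub_mul_cos (mul_ne_zero h2 hpi),
    integral_sin_const_mul (mul_ne_zero h3 hpi), integral_sin_const_mul (mul_ne_zero h4 hpi),
    c1, c2, c3, c4]
  · field_simp
    ring
  all_goals exact Continuous.intervalIntegrable (by fun_prop) _ _

theorem continuous_profileFT : Continuous profileFT := by
  unfold profileFT
  refine continuous_const.mul ?_
  exact intervalIntegral.continuous_parametric_intervalIntegral_of_continuous'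
    (f := fun x t => profile t * Real.cos (2 * Real.pi * x * t)) (by fun_prop) 0 1

/-- The rational factor of `profileFT` has the sign of `9 - 4 x²`. It is of order `x⁻⁴` because
the coefficient of the sine in `profile` cancels the terms of order `x⁻²`. -/
theorem rational_factor_eq {x : ℝ} (h1 : 2 * x + 1 ≠ 0) (h2 : 2 * x - 1 ≠ 0) (h3 : 3 + 2 * x ≠ 0)
    (h4 : 3 - 2 * x ≠ 0) :
    1 / (2 * x + 1) ^ 2 + 1 / (2 * x - 1) ^ 2 + 1 / 3 * (1 / (3 + 2 * x) + 1 / (3 - 2 * x))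
      = (24 * x ^ 2 + 10) * 2 / ((4 * x ^ 2 - 1) ^ 2 * (9 - 4 * x ^ 2)) := by
  have e1 : 4 * x ^ 2 - 1 = (2 * x + 1) * (2 * x - 1) := by ring
  have e2 : 9 - 4 * x ^ 2 = (3 + 2 * x) * (3 - 2 * x) := by ring
  rw [e1, e2]
  field_simp
  ring

theorem profileFT_nonpos_of_lt {x : ℝ} (hx : 3 / 2 < |x|) : profileFT x ≤ 0 := by
  have hx2 : 9 < 4 * x ^ 2 := by
    have : (3 / 2 : ℝ) ^ 2 < |x| ^ 2 := by gcongr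
    rw [sq_abs] at this; linarith
  have h1 : 2 * x + 1 ≠ 0 := fun h => by nlinarith
  have h2 : 2 * x - 1 ≠ 0 := fun h => by nlinarith
  have h3 : 3 + 2 * x ≠ 0 := fun h => by nlinarith
  have h4 : 3 - 2 * x ≠ 0 := fun h => by nlinarith
  rw [profileFT_eq h1 h2 h3 h4, rational_factor_eq h1 h2 h3 h4]
  refine mul_nonpos_of_nonneg_of_nonpos ?_ ?_
  · have := Real.neg_one_le_cos (2 * Real.pi * x)
    exact div_nonneg (by linarith) (by positivity)
  · exact div_nonpos_of_nonneg_of_nonpos (by positivity)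
      (mul_nonpos_of_nonneg_of_nonpos (by positivity) (by linarith))

/-- The closed form of `profileFT` breaks down at `±3/2`; continuity covers these points. -/
theorem profileFT_nonpos {x : ℝ} (hx : 3 / 2 ≤ |x|) : profileFT x ≤ 0 := by
  have hcl : IsClosed {x | profileFT x ≤ 0} := isClosed_le continuous_profileFT continuous_const
  have hsub : {x : ℝ | 3 / 2 < |x|} ⊆ {x | profileFT x ≤ 0} := fun x hx => profileFT_nonpos_of_lt hx
  refine hcl.closure_subset_iff.2 hsub ?_
  rcases le_abs.1 hx with h | h
  · have hm : Set.Ioi (3 / 2 : ℝ) ⊆ {x : ℝ | 3 / 2 < |x|} := fun y hy =>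
      Set.mem_ofPred.2 (lt_abs.2 (Or.inl (Set.mem_Ioi.1 hy)))
    refine closure_mono hm ?_
    rw [closure_Ioi]
    exact h
  · have hm : Set.Iio (-(3 / 2) : ℝ) ⊆ {x : ℝ | 3 / 2 < |x|} :=
      fun y hy =>
        Set.mem_ofPred.2 (lt_abs.2 (Or.inr (lt_neg_of_lt_neg (Set.mem_Iio.1 hy))))
    refine closure_mono hm ?_
    rw [closure_Iio]
    exact le_neg_of_le_neg h

/-- Four translates of the Fejér kernel `(sin (π x) / (π x))²` by consecutive integers sum to at
most one. With `α = π (2 x - 1) / 8` the numerators are all `(4 sin α cos α cos 2α)²`, and one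
factor of each is estimated by `|sin z| ≤ |z|`. -/
theorem fejer_four_le_one {x : ℝ} (h1 : 2 * x + 1 ≠ 0) (h2 : 2 * x - 1 ≠ 0) (h3 : 3 + 2 * x ≠ 0)
    (h4 : 3 - 2 * x ≠ 0) :
    2 * (1 + Real.cos (2 * Real.pi * x)) / Real.pi ^ 2 *
      (1 / (2 * x + 1) ^ 2 + 1 / (2 * x - 1) ^ 2 + 1 / (3 + 2 * x) ^ 2 + 1 / (3 - 2 * x) ^ 2)
      ≤ 1 := by
  have hpi := Real.pi_pos
  have hcos : ∀ a : ℝ, 1 - Real.cos (8 * a) =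
      32 * (Real.sin a * (Real.cos a * Real.cos (2 * a))) ^ 2 := by
    intro a
    have e : 8 * a = 2 * (2 * (2 * a)) := by ring
    rw [e, Real.cos_two_mul, Real.cos_two_mul (2 * a), Real.cos_two_mul a]
    have := Real.sin_sq_add_cos_sq a
    have hs : Real.sin a ^ 2 = 1 - Real.cos a ^ 2 := by linarith
    rw [mul_pow, hs]; ring
  have hterm : ∀ a : ℝ, a ≠ 0 → (1 - Real.cos (8 * a)) / a ^ 2 ≤
      32 * (Real.cos a * Real.cos (2 * a)) ^ 2 := by
    intro a ha
    rw [hcos a, div_le_iff₀ (by positivity), mul_pow]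
    have : Real.sin a ^ 2 ≤ a ^ 2 := sq_le_sq.2 Real.abs_sin_le_abs
    nlinarith [sq_nonneg (Real.cos a * Real.cos (2 * a))]
  set α := Real.pi * (2 * x - 1) / 8 with hα
  have n1 : α ≠ 0 := by rw [hα]; positivity
  have n2 : α + Real.pi / 4 ≠ 0 := by
    rw [show α + Real.pi / 4 = Real.pi * (2 * x + 1) / 8 by rw [hα]; ring]; positivity
  have n3 : α + Real.pi / 2 ≠ 0 := by
    rw [show α + Real.pi / 2 = Real.pi * (3 + 2 * x) / 8 by rw [hα]; ring]; positivity
  have n4 : α - Real.pi / 4 ≠ 0 := by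
    rw [show α - Real.pi / 4 = -(Real.pi * (3 - 2 * x) / 8) by rw [hα]; ring]
    exact neg_ne_zero.2 (by positivity)
  have t1 := hterm _ n1
  have t2 := hterm _ n2
  have t3 := hterm _ n3
  have t4 := hterm _ n4
  have hc : Real.cos (8 * α) = -Real.cos (2 * Real.pi * x) := by
    rw [← Real.cos_sub_pi]; congr 1; rw [hα]; ring
  have hc2 : Real.cos (8 * (α + Real.pi / 4)) = -Real.cos (2 * Real.pi * x) := by
    rw [← hc, ← Real.cos_add_two_pi (8 * α)]; congr 1; ring
  have hc3 : Real.cos (8 * (α + Real.pi / 2)) = -Real.cos (2 * Real.pi * x) := by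
    rw [← hc2, ← Real.cos_add_two_pi (8 * (α + Real.pi / 4))]; congr 1; ring
  have hc4 : Real.cos (8 * (α - Real.pi / 4)) = -Real.cos (2 * Real.pi * x) := by
    rw [← hc, ← Real.cos_sub_two_pi (8 * α)]; congr 1; ring
  rw [hc] at t1
  rw [hc2, show 2 * (α + Real.pi / 4) = 2 * α + Real.pi / 2 by ring, Real.cos_add_pi_div_two,
    Real.cos_add α, Real.cos_pi_div_four, Real.sin_pi_div_four] at t2
  rw [hc3, show 2 * (α + Real.pi / 2) = 2 * α + Real.pi by ring, Real.cos_add_pi,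
    Real.cos_add_pi_div_two] at t3
  rw [hc4, show 2 * (α - Real.pi / 4) = 2 * α - Real.pi / 2 by ring, Real.cos_sub_pi_div_two,
    Real.cos_sub α, Real.cos_pi_div_four, Real.sin_pi_div_four] at t4
  have hsum : 32 * (Real.cos α * Real.cos (2 * α)) ^ 2 +
      32 * ((Real.cos α * (√2 / 2) - Real.sin α * (√2 / 2)) * -Real.sin (2 * α)) ^ 2 +
      32 * (-Real.sin α * -Real.cos (2 * α)) ^ 2 +
      32 * ((Real.cos α * (√2 / 2) + Real.sin α * (√2 / 2)) * Real.sin (2 * α)) ^ 2 = 32 := by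
    have s2 : √2 ^ 2 = (2 : ℝ) := Real.sq_sqrt (by norm_num)
    have p1 := Real.sin_sq_add_cos_sq α
    have p2 := Real.sin_sq_add_cos_sq (2 * α)
    have : 32 * (Real.cos α * Real.cos (2 * α)) ^ 2 +
      32 * ((Real.cos α * (√2 / 2) - Real.sin α * (√2 / 2)) * -Real.sin (2 * α)) ^ 2 +
      32 * (-Real.sin α * -Real.cos (2 * α)) ^ 2 +
      32 * ((Real.cos α * (√2 / 2) + Real.sin α * (√2 / 2)) * Real.sin (2 * α)) ^ 2
      = 32 * (Real.sin α ^ 2 + Real.cos α ^ 2) *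
        (Real.cos (2 * α) ^ 2 + √2 ^ 2 / 2 * Real.sin (2 * α) ^ 2) := by ring
    rw [this, s2, p1]
    linarith
  have e : 2 * (1 + Real.cos (2 * Real.pi * x)) / Real.pi ^ 2 *
      (1 / (2 * x + 1) ^ 2 + 1 / (2 * x - 1) ^ 2 + 1 / (3 + 2 * x) ^ 2 + 1 / (3 - 2 * x) ^ 2)
      = ((1 - -Real.cos (2 * Real.pi * x)) / α ^ 2
        + (1 - -Real.cos (2 * Real.pi * x)) / (α + Real.pi / 4) ^ 2
        + (1 - -Real.cos (2 * Real.pi * x)) / (α + Real.pi / 2) ^ 2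
        + (1 - -Real.cos (2 * Real.pi * x)) / (α - Real.pi / 4) ^ 2) / 32 := by
    rw [show α + Real.pi / 4 = Real.pi * (2 * x + 1) / 8 by rw [hα]; ring,
      show α + Real.pi / 2 = Real.pi * (3 + 2 * x) / 8 by rw [hα]; ring,
      show α - Real.pi / 4 = -(Real.pi * (3 - 2 * x) / 8) by rw [hα]; ring, hα]
    field_simp
    ring
  rw [e]
  linarith

/-- Inside `(-3/2, 3/2)` the simple poles at `±3/2` in the closed form are dominated by the double
poles of two further translates of the Fejér kernel. -/
theorem profileFT_le_one_of_lt {x : ℝ} (hx : |x| < 3 / 2) (hx' : |x| ≠ 1 / 2) :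
    profileFT x ≤ 1 := by
  obtain ⟨ha, hb⟩ := abs_lt.1 hx
  have h1 : 2 * x + 1 ≠ 0 := fun h => hx' (by
    rw [show x = -(1 / 2) by linarith, abs_neg, abs_of_pos (by norm_num)])
  have h2 : 2 * x - 1 ≠ 0 := fun h => hx' (by
    rw [show x = 1 / 2 by linarith, abs_of_pos (by norm_num)])
  have h3 : 0 < 3 + 2 * x := by linarith
  have h4 : 0 < 3 - 2 * x := by linarith
  refine le_trans ?_ (fejer_four_le_one h1 h2 h3.ne' h4.ne')
  rw [profileFT_eq h1 h2 h3.ne' h4.ne']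
  refine mul_le_mul_of_nonneg_left ?_ ?_
  · have : 1 / 3 * (1 / (3 + 2 * x) + 1 / (3 - 2 * x)) ≤
        1 / (3 + 2 * x) ^ 2 + 1 / (3 - 2 * x) ^ 2 := by
      have e : 1 / (3 + 2 * x) ^ 2 + 1 / (3 - 2 * x) ^ 2
          - 1 / 3 * (1 / (3 + 2 * x) + 1 / (3 - 2 * x))
          = 16 * x ^ 2 / ((3 + 2 * x) ^ 2 * (3 - 2 * x) ^ 2) := by
        field_simp
        ring
      have : 0 ≤ 16 * x ^ 2 / ((3 + 2 * x) ^ 2 * (3 - 2 * x) ^ 2) := by positivity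
      linarith
    linarith
  · have := Real.neg_one_le_cos (2 * Real.pi * x)
    exact div_nonneg (by linarith) (by positivity)

/-- The points `±1/2`, excluded from the closed form, follow by continuity. -/
theorem profileFT_le_one (x : ℝ) : profileFT x ≤ 1 := by
  have hcl : IsClosed {x | profileFT x ≤ 1} := isClosed_le continuous_profileFT continuous_const
  have hd : Dense (({1 / 2, -(1 / 2)} : Set ℝ)ᶜ) :=
    Dense.sdiff_finite dense_univ (Set.toFinite _) |>.mono (fun y hy => hy.2)
  refine hcl.closure_subset_iff.2 ?_ (hd x)
  intro y hy
  rcases lt_or_ge |y| (3 / 2) with h | h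
  · refine profileFT_le_one_of_lt h fun h' => hy ?_
    rcases (abs_eq (by norm_num)).1 h' with h' | h' <;> simp [h']
  · exact (profileFT_nonpos h).trans zero_le_one

theorem abs_profileFT_le {x : ℝ} (hx : 2 ≤ |x|) : |profileFT x| ≤ 1 / x ^ 2 := by
  have hx2 : 4 ≤ x ^ 2 := by
    have : (2 : ℝ) ^ 2 ≤ |x| ^ 2 := by gcongr
    rw [sq_abs] at this; linarith
  have h1 : 2 * x + 1 ≠ 0 := fun h => by nlinarith
  have h2 : 2 * x - 1 ≠ 0 := fun h => by nlinarith
  have h3 : 3 + 2 * x ≠ 0 := fun h => by nlinarith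
  have h4 : 3 - 2 * x ≠ 0 := fun h => by nlinarith
  rw [profileFT_eq h1 h2 h3 h4, rational_factor_eq h1 h2 h3 h4, abs_mul]
  have hA : |2 * (1 + Real.cos (2 * Real.pi * x)) / Real.pi ^ 2| ≤ 4 / 9 := by
    have hc := Real.neg_one_le_cos (2 * Real.pi * x)
    have hc' := Real.cos_le_one (2 * Real.pi * x)
    rw [abs_of_nonneg (div_nonneg (by linarith) (by positivity)),
      div_le_iff₀ (by positivity)]
    nlinarith [Real.pi_gt_three]
  have hB : |(24 * x ^ 2 + 10) * 2 / ((4 * x ^ 2 - 1) ^ 2 * (9 - 4 * x ^ 2))| ≤ 1 / x ^ 2 := by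
    have h9 : 0 < 4 * x ^ 2 - 9 := by linarith
    have hq : 0 < (4 * x ^ 2 - 1) ^ 2 := by nlinarith
    rw [abs_div, abs_of_nonneg (by positivity), abs_mul, abs_of_pos hq, abs_sub_comm,
      abs_of_pos h9, div_le_div_iff₀ (by positivity) (by positivity)]
    nlinarith [mul_pos hq h9, mul_nonneg hq.le (by linarith : 0 ≤ 4 * x ^ 2 - 9 - 7)]
  calc _ ≤ 4 / 9 * (1 / x ^ 2) := by gcongr
    _ ≤ 1 / x ^ 2 := by
      have : 0 ≤ 1 / x ^ 2 := by positivity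
      linarith

/-! ### The localizing kernel on the circle and its Fourier series -/

/-- The localizing kernel on `ℝ / ℤ`: it vanishes at distance at least `r` from the origin, and its
`n`-th Fourier coefficient is `profileFT (n * r)`. -/
noncomputable def locKernel (r : ℝ) : C(UnitAddCircle, ℂ) where
  toFun θ := ((profile (min (‖θ‖ / r) 1) / r : ℝ) : ℂ)
  continuous_toFun := by fun_prop

theorem locKernel_apply (r : ℝ) (θ : UnitAddCircle) :
    locKernel r θ = ((profile (min (‖θ‖ / r) 1) / r : ℝ) : ℂ) := rfl

/-- The kernel is even, so its Fourier coefficients are cosine integrals. -/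
theorem fourierCoeff_locKernel {r : ℝ} (hr : 0 < r) (hr' : r ≤ 1 / 2) (n : ℤ) :
    fourierCoeff (locKernel r) n = ((profileFT (n * r) : ℝ) : ℂ) := by
  have hcont : ∀ m : ℤ, Continuous fun x : ℝ =>
      (fourier m (x : UnitAddCircle) : ℂ) • locKernel r (x : UnitAddCircle) := by
    intro m
    have hc : Continuous fun x : ℝ => (x : UnitAddCircle) := AddCircle.continuous_mk' 1
    exact ((fourier m).continuous.comp hc).smul ((locKernel r).continuous.comp hc)
  have hsymm : ∫ x in (-(1 / 2) : ℝ)..0,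
        (fourier (-n) (x : UnitAddCircle) : ℂ) • locKernel r (x : UnitAddCircle)
      = ∫ x in (0 : ℝ)..(1 / 2),
        (fourier n (x : UnitAddCircle) : ℂ) • locKernel r (x : UnitAddCircle) := by
    have := intervalIntegral.integral_comp_neg (a := 0) (b := 1 / 2)
      (fun x : ℝ => (fourier (-n) (x : UnitAddCircle) : ℂ) • locKernel r (x : UnitAddCircle))
    rw [neg_zero] at this
    rw [← this]
    refine intervalIntegral.integral_congr fun x _ => ?_
    simp only [locKernel_apply, AddCircle.coe_neg, norm_neg, fourier_apply]
    simp
  have hcos : ∀ x ∈ Set.uIcc (0 : ℝ) (1 / 2),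
      (fourier n (x : UnitAddCircle) : ℂ) • locKernel r (x : UnitAddCircle)
        + (fourier (-n) (x : UnitAddCircle) : ℂ) • locKernel r (x : UnitAddCircle)
      = ((2 * (profile (min (x / r) 1) / r * Real.cos (2 * Real.pi * n * x)) : ℝ) : ℂ) := by
    intro x hx
    rw [Set.uIcc_of_le (by norm_num)] at hx
    have hnx : ‖(x : UnitAddCircle)‖ = x := by
      rw [(AddCircle.norm_coe_eq_abs_iff (p := 1) one_ne_zero).2
        (by rw [abs_of_nonneg hx.1, abs_one]; exact hx.2), abs_of_nonneg hx.1]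
    rw [locKernel_apply, hnx, ← add_smul, fourier_coe_apply, fourier_coe_apply]
    have e1 : (2 * (Real.pi : ℂ) * Complex.I * (n : ℂ) * (x : ℂ) / ((1 : ℝ) : ℂ))
        = ((2 * Real.pi * n * x : ℝ) : ℂ) * Complex.I := by push_cast; ring
    have e2 : (2 * (Real.pi : ℂ) * Complex.I * ((-n : ℤ) : ℂ) * (x : ℂ) / ((1 : ℝ) : ℂ))
        = -((2 * Real.pi * n * x : ℝ) : ℂ) * Complex.I := by push_cast; ring
    rw [e1, e2, ← Complex.two_cos, ← Complex.ofReal_cos, smul_eq_mul]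
    push_cast
    ring
  have hreal : ∫ x in (0 : ℝ)..(1 / 2),
      2 * (profile (min (x / r) 1) / r * Real.cos (2 * Real.pi * n * x)) = profileFT (n * r) := by
    have hII : ∀ a b : ℝ, IntervalIntegrable
        (fun x => 2 * (profile (min (x / r) 1) / r * Real.cos (2 * Real.pi * n * x))) volume a b :=
      fun a b => Continuous.intervalIntegrable (by fun_prop) _ _
    have hzero : ∫ x in r..(1 / 2),
        2 * (profile (min (x / r) 1) / r * Real.cos (2 * Real.pi * n * x)) = 0 := by
      rw [intervalIntegral.integral_congr (g := fun _ => 0), intervalIntegral.integral_zero]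
      intro x hx
      rw [Set.uIcc_of_le hr'] at hx
      have : min (x / r) 1 = 1 := min_eq_right ((one_le_div hr).2 hx.1)
      simp [this, profile_one]
    rw [← intervalIntegral.integral_add_adjacent_intervals (hII 0 r) (hII r (1 / 2)), hzero,
      add_zero]
    have hsub := intervalIntegral.integral_comp_mul_right (a := 0) (b := 1)
      (fun x => 2 * (profile (min (x / r) 1) / r * Real.cos (2 * Real.pi * n * x))) hr.ne'
    rw [zero_mul, one_mul, smul_eq_mul, eq_inv_mul_iff_mul_eq₀ hr.ne'] at hsub
    rw [← hsub, profileFT, ← intervalIntegral.integral_const_mul,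
      ← intervalIntegral.integral_const_mul]
    refine intervalIntegral.integral_congr fun x hx => ?_
    rw [Set.uIcc_of_le zero_le_one] at hx
    have : min (x * r / r) 1 = x := by rw [mul_div_cancel_right₀ _ hr.ne', min_eq_left hx.2]
    simp only [this]
    rw [show 2 * Real.pi * (n * r) * x = 2 * Real.pi * n * (x * r) by ring]
    field_simp
  rw [fourierCoeff_eq_intervalIntegral _ n (-(1 / 2) : ℝ),
    show (-(1 / 2) : ℝ) + 1 = 1 / 2 by norm_num,
    ← intervalIntegral.integral_add_adjacent_intervals
      ((hcont (-n)).intervalIntegrable _ 0) ((hcont (-n)).intervalIntegrable 0 _), hsymm,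
    ← intervalIntegral.integral_add ((hcont n).intervalIntegrable _ _)
      ((hcont (-n)).intervalIntegrable _ _), intervalIntegral.integral_congr hcos,
    intervalIntegral.integral_ofReal, hreal]
  simp

theorem summable_profileFT {r : ℝ} (hr : 0 < r) :
    Summable fun n : ℤ => ((profileFT (n * r) : ℝ) : ℂ) := by
  have hs : Summable fun n : ℤ => 1 / r ^ 2 * (1 / (n : ℝ) ^ 2) :=
    (Real.summable_one_div_int_pow.2 one_lt_two).mul_left _
  refine hs.of_norm_bounded_eventually ?_
  rw [Filter.eventually_cofinite]
  refine (Set.finite_Icc (-⌈2 / r⌉) ⌈2 / r⌉).subset fun n hn => ?_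
  rw [Set.mem_Icc, ← abs_le]
  by_contra hcon
  refine hn ?_
  have h1 : (2 / r : ℝ) ≤ |(n : ℝ)| := by
    rw [← Int.cast_abs]
    exact (Int.le_ceil _).trans (by exact_mod_cast (not_le.1 hcon).le)
  rw [Complex.norm_real, Real.norm_eq_abs]
  refine (abs_profileFT_le ?_).trans_eq ?_
  · rw [abs_mul, abs_of_pos hr]
    rwa [div_le_iff₀ hr] at h1
  · rw [mul_pow]
    rcases eq_or_ne (n : ℝ) 0 with h | h
    · simp [h]
    · field_simp

theorem hasSum_locKernel {r : ℝ} (hr : 0 < r) (hr' : r ≤ 1 / 2) (θ : UnitAddCircle) :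
    HasSum (fun n : ℤ => ((profileFT (n * r) : ℝ) : ℂ) * fourier n θ) (locKernel r θ) := by
  have hs : Summable (fourierCoeff (locKernel r)) := by
    rw [show fourierCoeff (locKernel r) = fun n : ℤ => ((profileFT (n * r) : ℝ) : ℂ) from
      funext (fourierCoeff_locKernel hr hr')]
    exact summable_profileFT hr
  have := has_pointwise_sum_fourier_series_of_summable hs θ
  simpa only [fourierCoeff_locKernel hr hr', smul_eq_mul] using this

/-- The samples of an exponential sum on `[-N, N]` dominate the quadratic form of the localizing
kernel, because `profileFT (k * r)` is at most one for `|k| ≤ N` and nonpositive elsewhere. -/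
theorem re_sum_locKernel_le {ι : Type*} (s : Finset ι) (a : ι → ℂ) (y : ι → ℝ) (N : ℕ) {r : ℝ}
    (hr : 0 < r) (hr' : r ≤ 1 / 2) (hrN : 3 / 2 ≤ ((N : ℝ) + 1) * r) :
    (∑ i ∈ s, ∑ j ∈ s, a i * (starRingEnd ℂ) (a j) * locKernel r ((y i - y j : ℝ))).re ≤
      ∑ k ∈ Finset.Icc (-(N : ℤ)) N,
        ‖∑ i ∈ s, a i * Complex.exp (2 * Real.pi * Complex.I * y i * (k : ℝ))‖ ^ 2 := by
  set h : ℤ → ℂ := fun k => ∑ i ∈ s, a i * Complex.exp (2 * Real.pi * Complex.I * y i * (k : ℝ))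
    with hh
  have hexp : ∀ (k : ℤ) (i j : ι), Complex.exp (2 * Real.pi * Complex.I * y i * (k : ℝ)) *
      (starRingEnd ℂ) (Complex.exp (2 * Real.pi * Complex.I * y j * (k : ℝ)))
      = fourier k ((y i - y j : ℝ) : UnitAddCircle) := by
    intro k i j
    rw [fourier_coe_apply, ← Complex.exp_conj, ← Complex.exp_add]
    congr 1
    simp only [map_mul, Complex.conj_ofReal, Complex.conj_I, map_ofNat]
    push_cast
    ring
  have hsum : HasSum (fun k : ℤ => ((profileFT (k * r) * ‖h k‖ ^ 2 : ℝ) : ℂ))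
      (∑ i ∈ s, ∑ j ∈ s, a i * (starRingEnd ℂ) (a j) * locKernel r ((y i - y j : ℝ))) := by
    have := hasSum_sum (s := s) fun i _ => hasSum_sum (s := s) fun j _ =>
      (hasSum_locKernel hr hr' ((y i - y j : ℝ) : UnitAddCircle)).mul_left
        (a i * (starRingEnd ℂ) (a j))
    refine Eq.mp (congrArg (fun F => HasSum F _) (funext fun k => Eq.symm ?_)) this
    simp_rw [← hexp]
    have hnorm : ((‖h k‖ ^ 2 : ℝ) : ℂ) = h k * (starRingEnd ℂ) (h k) := by
      rw [Complex.mul_conj, Complex.normSq_eq_norm_sq]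
    rw [Complex.ofReal_mul, hnorm, hh]
    simp only [map_sum, map_mul]
    rw [Finset.sum_mul_sum, Finset.mul_sum]
    refine Finset.sum_congr rfl fun i _ => ?_
    rw [Finset.mul_sum]
    refine Finset.sum_congr rfl fun j _ => ?_
    ring
  have hre := Complex.hasSum_re hsum
  simp only [Complex.ofReal_re] at hre
  have hfin : HasSum (fun k : ℤ => if k ∈ Finset.Icc (-(N : ℤ)) N then ‖h k‖ ^ 2 else 0)
      (∑ k ∈ Finset.Icc (-(N : ℤ)) N, ‖h k‖ ^ 2) := by
    have := hasSum_sum_of_ne_finset_zero (L := .unconditional ℤ) (s := Finset.Icc (-(N : ℤ)) N)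
      (f := fun k : ℤ => if k ∈ Finset.Icc (-(N : ℤ)) N then ‖h k‖ ^ 2 else 0)
      fun k hk => if_neg hk
    rwa [Finset.sum_congr rfl fun k hk => if_pos hk] at this
  refine hasSum_le (fun k => ?_) hre hfin
  split_ifs with hk
  · exact mul_le_of_le_one_left (by positivity) (profileFT_le_one _)
  · refine mul_nonpos_of_nonpos_of_nonneg (profileFT_nonpos ?_) (by positivity)
    have hk' : (N : ℤ) + 1 ≤ |k| := by
      by_contra hcon
      exact hk (Finset.mem_Icc.2 (abs_le.1 (by omega)))
    have hk'' : (N : ℝ) + 1 ≤ |(k : ℝ)| := by rw [← Int.cast_abs]; exact_mod_cast hk'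
    rw [abs_mul, abs_of_pos hr]
    exact hrN.trans (mul_le_mul_of_nonneg_right hk'' hr.le)

/-! ### Wrap-around distance and the kernel -/

theorem wrapDist_eq_norm (y y' : ℝ) : wrapDist y y' = ‖((y - y' : ℝ) : UnitAddCircle)‖ := by
  rw [wrapDist_eq, UnitAddCircle.norm_eq]

theorem wrapDist_nonneg (y y' : ℝ) : 0 ≤ wrapDist y y' := by
  rw [wrapDist_eq]; exact abs_nonneg _

theorem wrapDist_self (y : ℝ) : wrapDist y y = 0 := by
  simp [wrapDist_eq]

theorem wrapDist_comm (y y' : ℝ) : wrapDist y y' = wrapDist y' y := by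
  rw [wrapDist_eq_norm, wrapDist_eq_norm, ← neg_sub, AddCircle.coe_neg, norm_neg]

theorem wrapDist_triangle (x y z : ℝ) : wrapDist x z ≤ wrapDist x y + wrapDist y z := by
  simp only [wrapDist_eq_norm]
  rw [show x - z = (x - y) + (y - z) by ring, AddCircle.coe_add]
  exact norm_add_le _ _

theorem eq_of_wrapDist_eq_zero {y y' : ℝ} (hy : y ∈ Set.Ico (0 : ℝ) 1) (hy' : y' ∈ Set.Ico (0 : ℝ) 1)
    (h : wrapDist y y' = 0) : y = y' := by
  rw [wrapDist_eq, abs_eq_zero, sub_eq_zero] at h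
  have h1 : (round (y - y') : ℝ) < 1 := by rw [← h]; linarith [hy.2, hy'.1]
  have h2 : (-1 : ℝ) < round (y - y') := by rw [← h]; linarith [hy.1, hy'.2]
  have h3 : round (y - y') = 0 := by
    have h1' : round (y - y') < 1 := by exact_mod_cast h1
    have h2' : -1 < round (y - y') := by exact_mod_cast h2
    omega
  rw [h3, Int.cast_zero] at h
  linarith

/-- The value of `locKernel r` at points of distance `d` from the origin. -/
noncomputable def radialKernel (r d : ℝ) : ℝ := profile (min (d / r) 1) / r

theorem locKernel_coe_sub (r y y' : ℝ) :
    locKernel r ((y - y' : ℝ) : UnitAddCircle) = (radialKernel r (wrapDist y y') : ℂ) := by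
  rw [locKernel_apply, wrapDist_eq_norm, radialKernel]

theorem radialKernel_zero (r : ℝ) : radialKernel r 0 = 2 / r := by
  simp [radialKernel, profile_zero]

theorem radialKernel_of_le {r d : ℝ} (hr : 0 < r) (h : r ≤ d) : radialKernel r d = 0 := by
  rw [radialKernel, min_eq_right ((one_le_div hr).2 h), profile_one, zero_div]

theorem neg_inv_le_radialKernel {r d : ℝ} (hr : 0 < r) (hd : 0 ≤ d) :
    -(1 / r) ≤ radialKernel r d := by
  rw [radialKernel, ← neg_div]
  gcongr
  exact neg_one_le_profile (le_min (by positivity) zero_le_one) (min_le_right _ _)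

theorem radialKernel_le {r d : ℝ} (hr : 0 < r) (hd : 0 ≤ d) (hdr : d ≤ r) :
    radialKernel r d ≤ 2 / r - Real.pi ^ 2 / 18 * d ^ 2 / r ^ 3 := by
  have h1 : d / r ≤ 1 := (div_le_one hr).2 hdr
  rw [radialKernel, min_eq_left h1]
  calc profile (d / r) / r ≤ (2 - Real.pi ^ 2 / 18 * (d / r) ^ 2) / r := by
        gcongr
        exact profile_le (by positivity) h1
    _ = _ := by field_simp

/-! ### The quadratic form of the kernel -/

namespace ExpSum

theorem norm_sq_sampleVec_sub (N : ℕ) (f g : ExpSum) :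
    ‖sampleVec N f - sampleVec N g‖ ^ 2
      = ∑ k ∈ Finset.Icc (-(N : ℤ)) N, ‖f.eval (k : ℝ) - g.eval (k : ℝ)‖ ^ 2 := by
  rw [EuclideanSpace.norm_sq_eq]
  exact Finset.sum_coe_sort (Finset.Icc (-(N : ℤ)) N)
    fun k => ‖f.eval (k : ℝ) - g.eval (k : ℝ)‖ ^ 2

/-- `re_sum_locKernel_le` for the frequencies of `f` with the coefficients of `f`, together with the
frequencies of `g` with the negated coefficients of `g`. -/
theorem quadForm_le (N : ℕ) (f g : ExpSum) {r : ℝ} (hr : 0 < r) (hr' : r ≤ 1 / 2)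
    (hrN : 3 / 2 ≤ ((N : ℝ) + 1) * r) :
    (∑ y ∈ f.freqs, ∑ y' ∈ f.freqs,
        (f.coeff y * (starRingEnd ℂ) (f.coeff y')).re * radialKernel r (wrapDist y y'))
      + (∑ y ∈ g.freqs, ∑ y' ∈ g.freqs,
        (g.coeff y * (starRingEnd ℂ) (g.coeff y')).re * radialKernel r (wrapDist y y'))
      - 2 * (∑ y ∈ f.freqs, ∑ y' ∈ g.freqs,
        (f.coeff y * (starRingEnd ℂ) (g.coeff y')).re * radialKernel r (wrapDist y y'))
      ≤ ‖sampleVec N f - sampleVec N g‖ ^ 2 := by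
  have key := re_sum_locKernel_le (f.freqs.disjSum g.freqs)
    (Sum.elim f.coeff fun y => -g.coeff y) (Sum.elim id id) N hr hr' hrN
  have hswap : ∑ y ∈ g.freqs, ∑ y' ∈ f.freqs,
        (g.coeff y * (starRingEnd ℂ) (f.coeff y')).re * radialKernel r (wrapDist y y')
      = ∑ y ∈ f.freqs, ∑ y' ∈ g.freqs,
        (f.coeff y * (starRingEnd ℂ) (g.coeff y')).re * radialKernel r (wrapDist y y') := by
    rw [Finset.sum_comm]
    refine Finset.sum_congr rfl fun y _ => Finset.sum_congr rfl fun y' _ => ?_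
    rw [wrapDist_comm]
    simp only [Complex.mul_re, Complex.conj_re, Complex.conj_im]
    ring
  rw [norm_sq_sampleVec_sub]
  refine le_trans (le_of_eq ?_) (key.trans_eq ?_)
  · simp only [Finset.sum_disjSum, Sum.elim_inl, Sum.elim_inr, id, locKernel_coe_sub,
      Finset.sum_add_distrib, Complex.add_re, Complex.re_sum, Complex.re_mul_ofReal, map_neg,
      neg_mul, mul_neg, Complex.neg_re, Finset.sum_neg_distrib, hswap]
    ring
  · refine Finset.sum_congr rfl fun k _ => ?_
    simp only [Finset.sum_disjSum, Sum.elim_inl, Sum.elim_inr, id, neg_mul,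
      Finset.sum_neg_distrib, ExpSum.eval, ← sub_eq_add_neg]

theorem sum_self_eq (f : ExpSum) {r : ℝ} (hr : 0 < r) (hf : f.WellSeparated (2 * r)) :
    ∑ y ∈ f.freqs, ∑ y' ∈ f.freqs,
        (f.coeff y * (starRingEnd ℂ) (f.coeff y')).re * radialKernel r (wrapDist y y')
      = ∑ y ∈ f.freqs, 2 / r * ‖f.coeff y‖ ^ 2 := by
  refine Finset.sum_congr rfl fun y hy => ?_
  rw [Finset.sum_eq_single_of_mem y hy]
  · rw [wrapDist_self, radialKernel_zero, Complex.mul_conj, Complex.ofReal_re,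
      Complex.normSq_eq_norm_sq, mul_comm]
  · intro y' hy' hne
    rw [radialKernel_of_le hr ((by linarith : r ≤ 2 * r).trans (hf y hy y' hy' hne.symm)), mul_zero]

/-- In a sum separated by `2 r`, at most one frequency is closer than `r` to a given point. -/
theorem WellSeparated.eq_of_lt {f : ExpSum} {r : ℝ} (hf : f.WellSeparated (2 * r)) {x y y' : ℝ}
    (hy : y ∈ f.freqs) (hy' : y' ∈ f.freqs) (h : wrapDist x y < r) (h' : wrapDist x y' < r) :
    y = y' := by
  by_contra hne
  have h1 := hf y hy y' hy' hne
  have h2 := wrapDist_triangle y x y'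
  rw [wrapDist_comm y x] at h2
  linarith

/-- The quadratic form that the kernel induces on a pair of coefficients at distance `d`. -/
noncomputable def pairForm (r d : ℝ) (c c' : ℂ) : ℝ :=
  2 / r * ‖c‖ ^ 2 + 2 / r * ‖c'‖ ^ 2 - 2 * ((c * (starRingEnd ℂ) c').re * radialKernel r d)

theorem le_pairForm {r d : ℝ} (hr : 0 < r) (hd : 0 ≤ d) (hdr : d ≤ r) (c c' : ℂ) :
    1 / (2 * r) * ‖c - c'‖ ^ 2 + Real.pi ^ 2 / 36 * d ^ 2 / r ^ 3 * ‖c + c'‖ ^ 2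
      ≤ pairForm r d c c' := by
  have h1 := neg_inv_le_radialKernel hr hd
  have h2 := radialKernel_le hr hd hdr
  have e : pairForm r d c c' = (2 / r + radialKernel r d) / 2 * ‖c - c'‖ ^ 2
      + (2 / r - radialKernel r d) / 2 * ‖c + c'‖ ^ 2 := by
    simp only [pairForm, ← Complex.normSq_eq_norm_sq, Complex.normSq_add, Complex.normSq_sub]
    ring
  rw [e]
  have e2 : 2 / r = 1 / r + 1 / r := by ring
  have e3 : 1 / (2 * r) = 1 / r / 2 := by field_simp
  refine add_le_add ?_ ?_
  · refine mul_le_mul_of_nonneg_right ?_ (by positivity)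
    linarith
  · refine mul_le_mul_of_nonneg_right ?_ (by positivity)
    have e4 : Real.pi ^ 2 / 36 * d ^ 2 / r ^ 3 = Real.pi ^ 2 / 18 * d ^ 2 / r ^ 3 / 2 := by ring
    linarith

/-- The quadratic form splits over the clusters of frequencies: the pairs `(y, n y)` for `y ∈ M`,
and the frequencies of `f` and of `g` that belong to no pair. -/
theorem sum_clusters_le (N : ℕ) (f g : ExpSum) {r : ℝ} (hr : 0 < r) (hr' : r ≤ 1 / 2)
    (hrN : 3 / 2 ≤ ((N : ℝ) + 1) * r) (hf : f.WellSeparated (2 * r))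
    (hg : g.WellSeparated (2 * r)) {M : Finset ℝ} (hM : M ⊆ f.freqs) {n : ℝ → ℝ}
    (hn : ∀ y ∈ M, n y ∈ g.freqs ∧ wrapDist y (n y) < r)
    (hMn : ∀ y ∈ f.freqs, y ∉ M → ∀ y' ∈ g.freqs, r ≤ wrapDist y y') :
    (∑ y ∈ M, pairForm r (wrapDist y (n y)) (f.coeff y) (g.coeff (n y)))
      + (∑ y ∈ f.freqs \ M, 2 / r * ‖f.coeff y‖ ^ 2)
      + (∑ y' ∈ g.freqs \ M.image n, 2 / r * ‖g.coeff y'‖ ^ 2)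
      ≤ ‖sampleVec N f - sampleVec N g‖ ^ 2 := by
  have hinj : Set.InjOn n M := by
    intro y hy z hz hyz
    refine hf.eq_of_lt (x := n y) (hM hy) (hM hz) ?_ ?_
    · rw [wrapDist_comm]; exact (hn y hy).2
    · rw [wrapDist_comm, hyz]; exact (hn z hz).2
  have himg : M.image n ⊆ g.freqs := Finset.image_subset_iff.2 fun y hy => (hn y hy).1
  have hcross : ∑ y ∈ f.freqs, ∑ y' ∈ g.freqs,
        (f.coeff y * (starRingEnd ℂ) (g.coeff y')).re * radialKernel r (wrapDist y y')
      = ∑ y ∈ M, (f.coeff y * (starRingEnd ℂ) (g.coeff (n y))).re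
          * radialKernel r (wrapDist y (n y)) := by
    rw [← Finset.sum_subset hM]
    · refine Finset.sum_congr rfl fun y hy => ?_
      refine Finset.sum_eq_single_of_mem (n y) (hn y hy).1 fun y' hy' hne => ?_
      have hle : r ≤ wrapDist y y' := by
        by_contra hlt
        exact hne (hg.eq_of_lt hy' (hn y hy).1 (not_le.1 hlt) (hn y hy).2)
      rw [radialKernel_of_le hr hle, mul_zero]
    · intro y hy hyM
      refine Finset.sum_eq_zero fun y' hy' => ?_
      rw [radialKernel_of_le hr (hMn y hy hyM y' hy'), mul_zero]
  have key := quadForm_le N f g hr hr' hrN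
  rw [sum_self_eq f hr hf, sum_self_eq g hr hg, hcross, ← Finset.sum_sdiff hM,
    ← Finset.sum_sdiff himg, Finset.sum_image hinj] at key
  refine le_trans (le_of_eq ?_) key
  simp only [pairForm, Finset.sum_sub_distrib, Finset.sum_add_distrib, Finset.mul_sum]
  ring

/-! ### Matching the frequencies -/

/-- If the samples are close, every frequency of `f` has a frequency of `g` nearby. An unmatched
frequency costs at least `2 / r * cmin ^ 2`, so that it can only exist if it is the only one and
all matched pairs cancel exactly; but then `f - g` is a single exponential, whose samples
have the larger squared norm `(2 N + 1) ‖c‖ ^ 2`. -/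
theorem exists_wrapDist_lt (N : ℕ) (f g : ExpSum) {r : ℝ} (hr : 0 < r) (hr' : r ≤ 1 / 2)
    (hrN : 3 / 2 ≤ ((N : ℝ) + 1) * r) (hrN' : 2 / r < 2 * (N : ℝ) + 1)
    (hf : f.WellSeparated (2 * r)) (hg : g.WellSeparated (2 * r)) {cmin : ℝ} (hcmin : 0 < cmin)
    (hfc : ∀ y ∈ f.freqs, cmin ≤ ‖f.coeff y‖) (hgc : ∀ y ∈ g.freqs, cmin ≤ ‖g.coeff y‖)
    (h : ‖sampleVec N f - sampleVec N g‖ ^ 2 ≤ 2 / r * cmin ^ 2) :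
    ∀ y ∈ f.freqs, ∃ y' ∈ g.freqs, wrapDist y y' < r := by
  classical
  by_contra! hcon
  obtain ⟨y₀, hy₀, hfar⟩ := hcon
  set M := f.freqs.filter fun y => ∃ y' ∈ g.freqs, wrapDist y y' < r with hMdef
  have hM : M ⊆ f.freqs := Finset.filter_subset _ _
  have hex : ∀ y ∈ M, ∃ y' ∈ g.freqs, wrapDist y y' < r := fun y hy => (Finset.mem_filter.1 hy).2
  choose! n hn using hex
  have hMn : ∀ y ∈ f.freqs, y ∉ M → ∀ y' ∈ g.freqs, r ≤ wrapDist y y' := by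
    intro y hy hyM y' hy'
    by_contra hlt
    exact hyM (Finset.mem_filter.2 ⟨hy, y', hy', not_le.1 hlt⟩)
  have hy₀M : y₀ ∉ M := fun hmem => by
    obtain ⟨y', hy', hlt⟩ := (Finset.mem_filter.1 hmem).2
    exact (hfar y' hy').not_gt hlt
  have key := sum_clusters_le N f g hr hr' hrN hf hg hM hn hMn
  have hA : 0 < 2 / r := by positivity
  have hpos : 0 < 2 / r * cmin ^ 2 := by positivity
  have hlow : ∀ c : ℂ, cmin ≤ ‖c‖ → 2 / r * cmin ^ 2 ≤ 2 / r * ‖c‖ ^ 2 := fun c hc => by gcongr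
  have hpair : ∀ y ∈ M, 0 ≤ pairForm r (wrapDist y (n y)) (f.coeff y) (g.coeff (n y)) :=
    fun y hy => le_trans (by positivity)
      (le_pairForm hr (wrapDist_nonneg _ _) (hn y hy).2.le _ _)
  have hS1 : 0 ≤ ∑ y ∈ M, pairForm r (wrapDist y (n y)) (f.coeff y) (g.coeff (n y)) :=
    Finset.sum_nonneg hpair
  have hS2 : (f.freqs \ M).card • (2 / r * cmin ^ 2)
      ≤ ∑ y ∈ f.freqs \ M, 2 / r * ‖f.coeff y‖ ^ 2 :=
    Finset.card_nsmul_le_sum _ _ _ fun y hy => hlow _ (hfc y (Finset.mem_sdiff.1 hy).1)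
  have hS3 : (g.freqs \ M.image n).card • (2 / r * cmin ^ 2)
      ≤ ∑ y ∈ g.freqs \ M.image n, 2 / r * ‖g.coeff y‖ ^ 2 :=
    Finset.card_nsmul_le_sum _ _ _ fun y hy => hlow _ (hgc y (Finset.mem_sdiff.1 hy).1)
  rw [nsmul_eq_mul] at hS2 hS3
  have hy₀mem : y₀ ∈ f.freqs \ M := Finset.mem_sdiff.2 ⟨hy₀, hy₀M⟩
  have hc1 : 1 ≤ (f.freqs \ M).card := Finset.card_pos.2 ⟨y₀, hy₀mem⟩
  have hc1' : (1 : ℝ) ≤ ((f.freqs \ M).card : ℝ) := by exact_mod_cast hc1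
  -- the bound on the norm leaves room for a single unmatched frequency and nothing else
  have hcount : ((f.freqs \ M).card : ℝ) + ((g.freqs \ M.image n).card : ℝ) ≤ 1 := by
    have : (((f.freqs \ M).card : ℝ) + ((g.freqs \ M.image n).card : ℝ)) * (2 / r * cmin ^ 2)
        ≤ 1 * (2 / r * cmin ^ 2) := by rw [add_mul]; linarith
    exact le_of_mul_le_mul_right this hpos
  have hcount' : (f.freqs \ M).card + (g.freqs \ M.image n).card ≤ 1 := by exact_mod_cast hcount
  have hG : g.freqs ⊆ M.image n :=
    Finset.sdiff_eq_empty_iff_subset.1 (Finset.card_eq_zero.1 (by omega))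
  have hG' : M.image n = g.freqs :=
    (Finset.image_subset_iff.2 fun y hy => (hn y hy).1).antisymm hG
  have hF : f.freqs \ M = {y₀} := by
    obtain ⟨z, hz⟩ := Finset.card_eq_one.1 (by omega : (f.freqs \ M).card = 1)
    rw [hz, Finset.mem_singleton] at hy₀mem
    rw [hz, hy₀mem]
  have hS1' : ∑ y ∈ M, pairForm r (wrapDist y (n y)) (f.coeff y) (g.coeff (n y)) = 0 := by
    refine le_antisymm ?_ hS1
    nlinarith [Nat.cast_nonneg (α := ℝ) (g.freqs \ M.image n).card]
  have hcancel : ∀ y ∈ M, n y = y ∧ f.coeff y = g.coeff y := by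
    intro y hy
    have hz := (Finset.sum_eq_zero_iff_of_nonneg hpair).1 hS1' y hy
    have hle := le_pairForm hr (wrapDist_nonneg y (n y)) (hn y hy).2.le (f.coeff y)
      (g.coeff (n y))
    rw [hz] at hle
    have t1 : 0 ≤ 1 / (2 * r) * ‖f.coeff y - g.coeff (n y)‖ ^ 2 := by positivity
    have t2 : 0 ≤ Real.pi ^ 2 / 36 * wrapDist y (n y) ^ 2 / r ^ 3
      * ‖f.coeff y + g.coeff (n y)‖ ^ 2 := by positivity
    have t1' : 1 / (2 * r) * ‖f.coeff y - g.coeff (n y)‖ ^ 2 = 0 := by linarith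
    have t2' : Real.pi ^ 2 / 36 * wrapDist y (n y) ^ 2 / r ^ 3
      * ‖f.coeff y + g.coeff (n y)‖ ^ 2 = 0 := by linarith
    have hceq : f.coeff y = g.coeff (n y) := by
      have : (1 / (2 * r) : ℝ) ≠ 0 := by positivity
      simpa [this, hr.ne', sub_eq_zero] using t1'
    have hfy : f.coeff y ≠ 0 := Finsupp.mem_support_iff.1 (hM hy)
    have hd : wrapDist y (n y) = 0 := by
      rw [← hceq, ← two_mul] at t2'
      simpa [Real.pi_ne_zero, hr.ne', hfy] using t2'
    have hny : y = n y := eq_of_wrapDist_eq_zero (f.freq_mem y (hM hy))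
      (g.freq_mem _ (hn y hy).1) hd
    exact ⟨hny.symm, by rw [hceq, ← hny]⟩
  have himg : M = g.freqs := by
    rw [← hG', Finset.image_congr (g := id) fun y hy => (hcancel y hy).1, Finset.image_id]
  have heval : ∀ k : ℝ, ‖f.eval k - g.eval k‖ = ‖f.coeff y₀‖ := by
    intro k
    have : f.eval k - g.eval k = f.coeff y₀ *
        Complex.exp (2 * (Real.pi : ℂ) * Complex.I * (y₀ : ℂ) * (k : ℂ)) := by
      rw [eval, eval, ← Finset.sum_sdiff hM, hF, Finset.sum_singleton, ← himg,
        Finset.sum_congr rfl fun y hy => by rw [(hcancel y hy).2], add_sub_cancel_right]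
    rw [this, norm_mul, show 2 * (Real.pi : ℂ) * Complex.I * (y₀ : ℂ) * (k : ℂ)
      = ((2 * Real.pi * y₀ * k : ℝ) : ℂ) * Complex.I by push_cast; ring,
      Complex.norm_exp_ofReal_mul_I, mul_one]
  rw [norm_sq_sampleVec_sub, Finset.sum_congr rfl fun k _ => by rw [heval], Finset.sum_const,
    Int.card_Icc, nsmul_eq_mul] at h
  have hcard : (((N : ℤ) + 1 - -(N : ℤ)).toNat : ℝ) = 2 * N + 1 := by
    have : ((N : ℤ) + 1 - -(N : ℤ)).toNat = 2 * N + 1 := by omega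
    rw [this]; push_cast; ring
  rw [hcard] at h
  have h1 : (2 * (N : ℝ) + 1) * cmin ^ 2 ≤ (2 * (N : ℝ) + 1) * ‖f.coeff y₀‖ ^ 2 := by
    gcongr
    exact hfc y₀ hy₀
  have h2 : 2 / r * cmin ^ 2 < (2 * (N : ℝ) + 1) * cmin ^ 2 :=
    mul_lt_mul_of_pos_right hrN' (by positivity)
  linarith

/-- The asserted implication with the exact squared norm in place of the error estimator. -/
theorem matching_of_norm_sq_le (N : ℕ) (hN : 2 ≤ N) (f g : ExpSum) {q : ℝ}
    (hq : 3 / (2 * (N : ℝ) + 2) ≤ q) (hf : f.WellSeparated (2 * q)) (hg : g.WellSeparated (2 * q))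
    {cmin : ℝ} (hcmin : 0 < cmin)
    (hfc : ∀ y ∈ f.freqs, cmin ≤ ‖f.coeff y‖) (hgc : ∀ y ∈ g.freqs, cmin ≤ ‖g.coeff y‖)
    (h : ‖sampleVec N f - sampleVec N g‖ ^ 2 ≤ (4 * (N : ℝ) + 4) / 3 * cmin ^ 2) :
    (∀ y ∈ f.freqs, ∃! y', y' ∈ g.freqs ∧ wrapDist y y' < 3 / (2 * (N : ℝ) + 2)) ∧
    (∀ y' ∈ g.freqs, ∃! y, y ∈ f.freqs ∧ wrapDist y y' < 3 / (2 * (N : ℝ) + 2)) ∧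
    ∀ n : ℝ → ℝ,
      (∀ y ∈ f.freqs, n y ∈ g.freqs ∧ wrapDist y (n y) < 3 / (2 * (N : ℝ) + 2)) →
      ∑ y ∈ f.freqs,
          (((N : ℝ) + 1) / 3 * ‖f.coeff y - g.coeff (n y)‖ ^ 2
            + 2 * Real.pi ^ 2 * ((N : ℝ) + 1) ^ 3 / 3 ^ 5 * wrapDist y (n y) ^ 2
              * ‖f.coeff y + g.coeff (n y)‖ ^ 2)
        ≤ ‖sampleVec N f - sampleVec N g‖ ^ 2 := by
  have hN' : (2 : ℝ) ≤ N := by exact_mod_cast hN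
  set r : ℝ := 3 / (2 * (N : ℝ) + 2) with hrdef
  have hr : 0 < r := by positivity
  have hr' : r ≤ 1 / 2 := by
    rw [hrdef, div_le_div_iff₀ (by positivity) (by norm_num)]; linarith
  have hrN : 3 / 2 ≤ ((N : ℝ) + 1) * r := by
    refine le_of_eq ?_
    rw [hrdef]; field_simp
  have hA : (4 * (N : ℝ) + 4) / 3 = 2 / r := by
    rw [hrdef]; field_simp; ring
  have hrN' : 2 / r < 2 * (N : ℝ) + 1 := by rw [← hA]; linarith
  have hf' : f.WellSeparated (2 * r) := fun y hy y' hy' hne =>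
    (by linarith : 2 * r ≤ 2 * q).trans (hf y hy y' hy' hne)
  have hg' : g.WellSeparated (2 * r) := fun y hy y' hy' hne =>
    (by linarith : 2 * r ≤ 2 * q).trans (hg y hy y' hy' hne)
  rw [hA] at h
  refine ⟨fun y hy => ?_, fun y' hy' => ?_, fun n hn => ?_⟩
  · obtain ⟨y', hy', hlt⟩ := exists_wrapDist_lt N f g hr hr' hrN hrN' hf' hg' hcmin hfc hgc h y hy
    exact ⟨y', ⟨hy', hlt⟩, fun z hz => hg'.eq_of_lt hz.1 hy' hz.2 hlt⟩
  -- existence follows from `exists_wrapDist_lt` with `f` and `g` exchanged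
  · rw [norm_sub_rev] at h
    obtain ⟨y, hy, hlt⟩ :=
      exists_wrapDist_lt N g f hr hr' hrN hrN' hg' hf' hcmin hgc hfc h y' hy'
    refine ⟨y, ⟨hy, by rwa [wrapDist_comm]⟩, fun z hz => hf'.eq_of_lt hz.1 hy ?_ hlt⟩
    rw [wrapDist_comm]
    exact hz.2
  · have key := sum_clusters_le N f g hr hr' hrN hf' hg' (Finset.Subset.refl _) hn
      fun y hy hyM => absurd hy hyM
    have h3 : 0 ≤ ∑ y' ∈ g.freqs \ f.freqs.image n, 2 / r * ‖g.coeff y'‖ ^ 2 :=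
      Finset.sum_nonneg fun _ _ => by positivity
    rw [Finset.sdiff_self, Finset.sum_empty, add_zero] at key
    refine le_trans (Finset.sum_le_sum fun y hy => ?_) ((le_add_of_nonneg_right h3).trans key)
    refine le_trans (le_of_eq ?_) (le_pairForm hr (wrapDist_nonneg _ _) (hn y hy).2.le _ _)
    have e1 : ((N : ℝ) + 1) / 3 = 1 / (2 * r) := by
      rw [hrdef]; field_simp
    have e2 : 2 * Real.pi ^ 2 * ((N : ℝ) + 1) ^ 3 / 3 ^ 5 * wrapDist y (n y) ^ 2
        = Real.pi ^ 2 / 36 * wrapDist y (n y) ^ 2 / r ^ 3 := by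
      rw [hrdef, show 2 * (N : ℝ) + 2 = 2 * (N + 1) by ring]; field_simp; ring
    rw [e1, e2]

end ExpSum

/-! ### Tail bounds for the noise -/

section Noise

variable {Ω : Type*} [MeasurableSpace Ω] {P : Measure Ω}
  {ι : Type*} [Fintype ι] {σ : ℝ≥0}

theorem hasSubgaussianMGF_of_hasLaw_gaussianReal {X : Ω → ℝ} {v : ℝ≥0}
    (hX : HasLaw X (gaussianReal 0 v) P) : HasSubgaussianMGF X v P where
  integrable_exp_mul t := by
    have h := integrable_exp_mul_gaussianReal (μ := 0) (v := v) t
    rw [← hX.map_eq] at h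
    exact h.comp_aemeasurable hX.aemeasurable
  mgf_le t := by
    rw [mgf_gaussianReal hX.map_eq, zero_mul, zero_add]

/-- Lower tail of a linear form in independent centred Gaussian variables. -/
theorem measureReal_linear_le (X : ι → Ω → ℝ) (hX : ∀ i, HasLaw (X i) (gaussianReal 0 (σ ^ 2)) P)
    (hindep : iIndepFun X P) (a : ι → ℝ) {H s : ℝ} (hH : 0 < H) (hHa : ∑ i, a i ^ 2 = H ^ 2)
    (hσ : 0 < σ) (hs : 0 ≤ s) :
    P.real {ω | ∑ i, a i * X i ω ≤ -(σ * H * s)} ≤ Real.exp (-s ^ 2 / 2) := by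
  have hsub : ∀ i ∈ Finset.univ, HasSubgaussianMGF (fun ω => -a i * X i ω)
      (‖a i‖₊ ^ 2 * σ ^ 2) P := by
    intro i _
    have h := (hasSubgaussianMGF_of_hasLaw_gaussianReal (hX i)).const_mul (-a i)
    convert h using 2
    refine NNReal.eq ?_
    change ‖a i‖ ^ 2 * (σ : ℝ) ^ 2 = (-a i) ^ 2 * (σ : ℝ) ^ 2
    rw [Real.norm_eq_abs, sq_abs, neg_sq]
  have hind : iIndepFun (fun i ω => -a i * X i ω) P :=
    hindep.comp (fun i x => -a i * x) fun i => by fun_prop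
  have hσ' : (0 : ℝ) < σ := hσ
  have key := HasSubgaussianMGF.measure_sum_ge_le_of_iIndepFun hind hsub
    (ε := σ * H * s) (by positivity)
  have hset : {ω | ∑ i, a i * X i ω ≤ -(σ * H * s)} = {ω | σ * H * s ≤ ∑ i, -a i * X i ω} := by
    ext ω
    simp only [Set.mem_ofPred_eq, neg_mul, Finset.sum_neg_distrib]
    exact le_neg
  rw [hset]
  refine key.trans_eq ?_
  congr 1
  have : ∑ i, ((‖a i‖₊ ^ 2 * σ ^ 2 : ℝ≥0) : ℝ) = H ^ 2 * σ ^ 2 := by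
    simp [← Finset.sum_mul, hHa]
  rw [NNReal.coe_sum, this]
  field_simp

theorem log_one_add_ge {u : ℝ} (hu : 0 ≤ u) : u - u ^ 2 / 2 ≤ Real.log (1 + u) := by
  refine le_trans ?_ (Real.le_log_one_add_of_nonneg hu)
  rw [le_div_iff₀ (by positivity)]
  nlinarith [pow_nonneg hu 3]

/-- The Laplace transform `(1 + 2 t v) ^ (-1/2)` of the square of a centred Gaussian variable of
variance `v`, estimated from above. -/
theorem mgf_sq_gaussian_le {X : Ω → ℝ} {v : ℝ≥0} (hv : v ≠ 0)
    (hX : HasLaw X (gaussianReal 0 v) P) {t : ℝ} (ht : 0 ≤ t) :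
    mgf (fun ω => X ω ^ 2) P (-t) ≤ Real.exp (-(t * v) + (t * v) ^ 2) := by
  have hv' : (0 : ℝ) < v := by positivity
  have h1 : mgf (fun ω => X ω ^ 2) P (-t) = ∫ x, Real.exp (-t * x ^ 2) ∂gaussianReal 0 v :=
    hX.integral_comp (f := fun x => Real.exp (-t * x ^ 2)) (by fun_prop)
  have h2 : ∫ x, Real.exp (-t * x ^ 2) ∂gaussianReal 0 v = (√(1 + 2 * (t * v)))⁻¹ := by
    rw [integral_gaussianReal_eq_integral_smul hv]
    have : ∀ x : ℝ, gaussianPDFReal 0 v x • Real.exp (-t * x ^ 2)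
        = (√(2 * Real.pi * v))⁻¹ * Real.exp (-(t + 1 / (2 * v)) * x ^ 2) := by
      intro x
      rw [gaussianPDFReal, smul_eq_mul, mul_assoc, ← Real.exp_add]
      congr 2
      ring
    simp_rw [this]
    rw [integral_const_mul, integral_gaussian, ← Real.sqrt_inv, ← Real.sqrt_inv,
      ← Real.sqrt_mul (by positivity)]
    congr 1
    have := Real.pi_ne_zero
    field_simp
    ring
  rw [h1, h2]
  have h3 : 0 < 1 + 2 * (t * v) := by positivity
  rw [← Real.exp_log (x := (√(1 + 2 * (t * v)))⁻¹) (by positivity), Real.log_inv,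
    Real.log_sqrt h3.le, Real.exp_le_exp]
  have := log_one_add_ge (u := 2 * (t * v)) (by positivity)
  nlinarith

/-- Lower tail of the sum of squares of independent centred Gaussian variables. -/
theorem measureReal_sum_sq_le [IsProbabilityMeasure P] (X : ι → Ω → ℝ)
    (hX : ∀ i, HasLaw (X i) (gaussianReal 0 (σ ^ 2)) P) (hindep : iIndepFun X P) (hσ : 0 < σ)
    {ε : ℝ} (hε : 0 ≤ ε) :
    P.real {ω | ∑ i, X i ω ^ 2 ≤ Fintype.card ι * σ ^ 2 * (1 - ε)}
      ≤ Real.exp (-(Fintype.card ι * ε ^ 2 / 4)) := by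
  have hσ' : (0 : ℝ) < σ := hσ
  set t : ℝ := ε / (2 * σ ^ 2) with ht
  have ht0 : 0 ≤ t := by positivity
  have hmeas : ∀ i, AEMeasurable (fun ω => X i ω ^ 2) P := fun i => (hX i).aemeasurable.pow_const 2
  have hind : iIndepFun (fun i ω => X i ω ^ 2) P :=
    hindep.comp (fun _ x => x ^ 2) fun i => by fun_prop
  have hint : Integrable (fun ω => Real.exp (-t * (∑ i, fun ω => X i ω ^ 2) ω)) P := by
    refine Integrable.of_bound (C := 1) ?_ (Filter.Eventually.of_forall fun ω => ?_)
    · refine AEMeasurable.aestronglyMeasurable ?_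
      refine Real.measurable_exp.comp_aemeasurable (AEMeasurable.const_mul ?_ _)
      exact Finset.aemeasurable_sum _ fun i _ => hmeas i
    · rw [Real.norm_eq_abs, Real.abs_exp, Real.exp_le_one_iff, Finset.sum_apply, neg_mul,
        neg_nonpos]
      positivity
  have key := measure_le_le_exp_mul_mgf (μ := P) (X := ∑ i, fun ω => X i ω ^ 2) (t := -t)
    (Fintype.card ι * σ ^ 2 * (1 - ε)) (neg_nonpos.2 ht0) hint
  simp only [Finset.sum_apply] at key
  refine key.trans ?_
  rw [hind.mgf_sum₀ hmeas]
  have hprod : ∏ i, mgf (fun ω => X i ω ^ 2) P (-t)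
      ≤ ∏ _i : ι, Real.exp (-(t * σ ^ 2) + (t * σ ^ 2) ^ 2) := by
    refine Finset.prod_le_prod (fun i _ => mgf_nonneg) fun i _ => ?_
    exact mod_cast mgf_sq_gaussian_le (v := σ ^ 2) (by positivity) (hX i) ht0
  refine (mul_le_mul_of_nonneg_left hprod (Real.exp_pos _).le).trans_eq ?_
  rw [Finset.prod_const, Finset.card_univ, ← Real.exp_nat_mul, ← Real.exp_add]
  congr 1
  rw [ht]
  field_simp
  ring

end Noise

/-! ### The error estimator -/

/-- The real and imaginary parts of the entries of `v`, indexed like the noise variables; they are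
the coefficients of `Re ⟪v, η⟫` as a linear form in these variables. -/
def realCoords {N : ℕ} (v : EuclideanSpace ℂ (SampleIdx N)) (p : SampleIdx N × Fin 2) : ℝ :=
  if p.2 = 0 then (v p.1).re else (v p.1).im

theorem sum_realCoords_sq {N : ℕ} (v : EuclideanSpace ℂ (SampleIdx N)) :
    ∑ p, realCoords v p ^ 2 = ‖v‖ ^ 2 := by
  rw [EuclideanSpace.norm_sq_eq, Fintype.sum_prod_type]
  refine Finset.sum_congr rfl fun k _ => ?_
  rw [Fin.sum_univ_two, ← Complex.normSq_eq_norm_sq, Complex.normSq_apply]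
  simp [realCoords]
  ring

theorem norm_sq_add_noiseVec {Ω : Type*} {N : ℕ} (v : EuclideanSpace ℂ (SampleIdx N))
    (X : SampleIdx N → Fin 2 → Ω → ℝ) (ω : Ω) :
    ‖v + noiseVec N X ω‖ ^ 2 = ‖v‖ ^ 2 + 2 * ∑ p : SampleIdx N × Fin 2,
      realCoords v p * X p.1 p.2 ω + ∑ p : SampleIdx N × Fin 2, X p.1 p.2 ω ^ 2 := by
  rw [← sum_realCoords_sq, ← sum_realCoords_sq, Finset.mul_sum, ← Finset.sum_add_distrib,
    ← Finset.sum_add_distrib, Fintype.sum_prod_type, Fintype.sum_prod_type]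
  refine Finset.sum_congr rfl fun k _ => ?_
  rw [Fin.sum_univ_two, Fin.sum_univ_two]
  simp [realCoords, noiseVec]
  ring

theorem card_sampleIdx_prod (N : ℕ) :
    (Fintype.card (SampleIdx N × Fin 2) : ℝ) = 2 * (2 * (N : ℝ) + 1) := by
  have h : Fintype.card (SampleIdx N × Fin 2) = (2 * N + 1) * 2 := by
    rw [Fintype.card_prod, Fintype.card_fin, Fintype.card_coe, Int.card_Icc]
    congr 1
    omega
  rw [h]
  push_cast
  ring

/-- Deterministic part of the error estimate: `H` is the norm of the exact residual, `L` the linear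
form of the noise, `W` the centred sum of squares, and `b = σ (2 N + 1) ^ ((1 + δ) / 4)`. -/
theorem sq_le_of_noise_bounds {H L W b : ℝ} (hb : 0 ≤ b) (hL : -(√2 * b * H) ≤ L)
    (hW : -(√2 * b ^ 2) ≤ W) (hH : 0 ≤ H) :
    H ^ 2 ≤ (√|H ^ 2 + 2 * L + W| + (2 + √2) * b) ^ 2 := by
  set a := √|H ^ 2 + 2 * L + W| with ha
  have ha0 : 0 ≤ a := Real.sqrt_nonneg _
  have ha2 : a ^ 2 = |H ^ 2 + 2 * L + W| := Real.sq_sqrt (abs_nonneg _)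
  have hs2 : √2 ^ 2 = (2 : ℝ) := Real.sq_sqrt (by norm_num)
  have hs0 : 0 ≤ √2 := Real.sqrt_nonneg 2
  have hs : √2 ≤ 2 := by nlinarith
  have hle := le_abs_self (H ^ 2 + 2 * L + W)
  -- completing the square leaves `(2 + √2) b²`, which is at most `(2 b)²`
  have h1 : (H - √2 * b) ^ 2 ≤ (a + 2 * b) ^ 2 := by
    have e : (H - √2 * b) ^ 2 = H ^ 2 - 2 * (√2 * b * H) + √2 ^ 2 * b ^ 2 := by ring
    rw [e, hs2]
    nlinarith [mul_nonneg ha0 hb, mul_nonneg (sub_nonneg.2 hs) (sq_nonneg b)]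
  have h2 : H - √2 * b ≤ a + 2 * b := le_of_sq_le_sq h1 (by positivity)
  exact pow_le_pow_left₀ hH (by linarith) 2

/-- With high probability the error estimator bounds the squared norm of the exact residual `v`. -/
theorem prob_norm_sq_le_errorEstimator {Ω : Type*} [MeasurableSpace Ω] (P : Measure Ω)
    [IsProbabilityMeasure P] (N : ℕ) (v : EuclideanSpace ℂ (SampleIdx N))
    (σ : ℝ≥0) (X : SampleIdx N → Fin 2 → Ω → ℝ)
    (hX : ∀ k j, HasLaw (X k j) (gaussianReal 0 (σ ^ 2)) P)
    (hindep : iIndepFun (fun p : SampleIdx N × Fin 2 => X p.1 p.2) P) (δ : ℝ) :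
    1 - Real.exp (-(2 * (N : ℝ) + 1) ^ ((1 + δ) / 2))
        - 2 * Real.exp (-(2 * (N : ℝ) + 1) ^ δ / 8)
      ≤ P.real {ω | ‖v‖ ^ 2 ≤ errorEstimator N σ δ (v + noiseVec N X ω)} := by
  set D : ℝ := 2 * (N : ℝ) + 1 with hD
  have hD0 : 0 < D := by positivity
  set m : ℝ := D ^ ((1 + δ) / 4) with hm
  have hm0 : 0 < m := Real.rpow_pos_of_pos hD0 _
  have hm2 : m ^ 2 = D ^ ((1 + δ) / 2) := by
    rw [hm, ← Real.rpow_natCast, ← Real.rpow_mul hD0.le]; congr 1; push_cast; ring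
  have hm4 : m ^ 4 = D * D ^ δ := by
    rw [hm, ← Real.rpow_natCast, ← Real.rpow_mul hD0.le, show D * D ^ δ = D ^ (1 + δ) by
      rw [Real.rpow_add hD0, Real.rpow_one]]
    congr 1; push_cast; ring
  have hexp1 : 0 < Real.exp (-D ^ ((1 + δ) / 2)) := Real.exp_pos _
  have hexp2 : 0 < Real.exp (-D ^ δ / 8) := Real.exp_pos _
  set G : Set Ω := {ω | ‖v‖ ^ 2 ≤ errorEstimator N σ δ (v + noiseVec N X ω)} with hG
  -- for `v = 0` or `σ = 0` the linear form is degenerate, and the tail bound is of no use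
  rcases eq_or_ne v 0 with hv | hv
  · have : G = Set.univ := by
      refine Set.eq_univ_of_forall fun ω => ?_
      rw [hG, Set.mem_ofPred_eq, hv, errorEstimator]
      simpa using sq_nonneg _
    rw [this, probReal_univ]
    linarith
  rcases eq_or_ne σ 0 with hσ | hσ
  · have hae : ∀ᵐ ω ∂P, ∀ p : SampleIdx N × Fin 2, X p.1 p.2 ω = 0 := by
      rw [ae_all_iff]
      intro p
      have h := hX p.1 p.2
      rw [hσ, zero_pow two_ne_zero, gaussianReal_zero_var] at h
      exact h.ae_eq_of_dirac
    have hGae : G =ᵐ[P] Set.univ := by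
      rw [Filter.eventuallyEq_univ]
      filter_upwards [hae] with ω hω
      rw [hG, Set.mem_ofPred_eq, errorEstimator, norm_sq_add_noiseVec, hσ]
      simp [hω]
    rw [measureReal_congr hGae, probReal_univ]
    linarith
  have hσ0 : 0 < σ := pos_iff_ne_zero.2 hσ
  have hσ' : (0 : ℝ) < σ := hσ0
  have hH : 0 < ‖v‖ := norm_pos_iff.2 hv
  have hX' : ∀ p : SampleIdx N × Fin 2, HasLaw (X p.1 p.2) (gaussianReal 0 (σ ^ 2)) P :=
    fun p => hX p.1 p.2
  have hB1 := measureReal_linear_le (fun p : SampleIdx N × Fin 2 => X p.1 p.2) hX' hindep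
    (realCoords v) hH (sum_realCoords_sq v) hσ0 (s := √2 * m) (by positivity)
  -- the relative deviation for which `2 D σ² ε = √2 σ² m²`
  have hB2 := measureReal_sum_sq_le (fun p : SampleIdx N × Fin 2 => X p.1 p.2) hX' hindep hσ0
    (ε := √2 * m ^ 2 / (2 * D)) (by positivity)
  have hs2 : √2 ^ 2 = (2 : ℝ) := Real.sq_sqrt (by norm_num)
  rw [mul_pow, hs2, show -(2 * m ^ 2) / 2 = -m ^ 2 by ring, hm2] at hB1
  have hexpo : (Fintype.card (SampleIdx N × Fin 2) : ℝ) * (√2 * m ^ 2 / (2 * D)) ^ 2 / 4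
      = D ^ δ / 4 := by
    rw [card_sampleIdx_prod, ← hD, div_pow, mul_pow, hs2, ← pow_mul, hm4]
    field_simp
  have hthr : (Fintype.card (SampleIdx N × Fin 2) : ℝ) * (σ : ℝ) ^ 2 * (1 - √2 * m ^ 2 / (2 * D))
      = 2 * D * σ ^ 2 - √2 * (σ * m) ^ 2 := by
    rw [card_sampleIdx_prod, ← hD]
    field_simp
  rw [hexpo, hthr] at hB2
  have hB2' : Real.exp (-(D ^ δ / 4)) ≤ Real.exp (-D ^ δ / 8) := by
    rw [Real.exp_le_exp]
    have := Real.rpow_nonneg hD0.le δ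
    linarith
  set B1 : Set Ω := {ω | ∑ p : SampleIdx N × Fin 2, realCoords v p * X p.1 p.2 ω
    ≤ -(σ * ‖v‖ * (√2 * m))} with hB1def
  set B2 : Set Ω := {ω | ∑ p : SampleIdx N × Fin 2, X p.1 p.2 ω ^ 2
    ≤ 2 * D * σ ^ 2 - √2 * (σ * m) ^ 2} with hB2def
  have hcover : (Set.univ : Set Ω) ⊆ G ∪ (B1 ∪ B2) := by
    intro ω _
    by_cases h1 : ω ∈ B1
    · exact Or.inr (Or.inl h1)
    by_cases h2 : ω ∈ B2
    · exact Or.inr (Or.inr h2)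
    refine Or.inl ?_
    rw [hB1def, Set.mem_ofPred_eq, not_le] at h1
    rw [hB2def, Set.mem_ofPred_eq, not_le] at h2
    rw [hG, Set.mem_ofPred_eq, errorEstimator, norm_sq_add_noiseVec]
    have := sq_le_of_noise_bounds (H := ‖v‖) (b := σ * m)
      (L := ∑ p : SampleIdx N × Fin 2, realCoords v p * X p.1 p.2 ω)
      (W := ∑ p : SampleIdx N × Fin 2, X p.1 p.2 ω ^ 2 - 2 * D * σ ^ 2)
      (by positivity) (by linarith) (by linarith) hH.le
    rw [← hD, ← hm]
    convert this using 3
    · congr 2; ring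
    · ring
  have hle : (1 : ℝ) ≤ P.real G + (P.real B1 + P.real B2) := by
    calc (1 : ℝ) = P.real Set.univ := probReal_univ.symm
      _ ≤ P.real (G ∪ (B1 ∪ B2)) := measureReal_mono hcover
      _ ≤ P.real G + P.real (B1 ∪ B2) := measureReal_union_le _ _
      _ ≤ _ := by gcongr; exact measureReal_union_le _ _
  linarith

/-- For `N ≤ 2` the asserted lower bound of the probability is not positive. -/
theorem prob_bound_nonpos {N : ℕ} (hN : N ≤ 2) {δ : ℝ} (hδ : δ ∈ Set.Ioo (0 : ℝ) 1) :
    1 - Real.exp (-(2 * (N : ℝ) + 1) ^ ((1 + δ) / 2))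
        - 2 * Real.exp (-(2 * (N : ℝ) + 1) ^ δ / 8) ≤ 0 := by
  have hN' : (N : ℝ) ≤ 2 := by exact_mod_cast hN
  have hN0 : (0 : ℝ) ≤ N := Nat.cast_nonneg N
  have h1 : (2 * (N : ℝ) + 1) ^ δ ≤ 5 := by
    calc (2 * (N : ℝ) + 1) ^ δ ≤ (2 * (N : ℝ) + 1) ^ (1 : ℝ) :=
          Real.rpow_le_rpow_of_exponent_le (by linarith) hδ.2.le
      _ ≤ 5 := by rw [Real.rpow_one]; linarith
  have h2 : (1 / 2 : ℝ) ≤ Real.exp (-(2 * (N : ℝ) + 1) ^ δ / 8) := by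
    rw [← Real.exp_log (x := (1 / 2 : ℝ)) (by norm_num), Real.exp_le_exp, one_div, Real.log_inv]
    linarith [Real.log_two_gt_d9]
  have h3 := Real.exp_pos (-(2 * (N : ℝ) + 1) ^ ((1 + δ) / 2))
  linarith

theorem mainTheorem6 {Ω : Type*} [MeasurableSpace Ω] (P : Measure Ω) [IsProbabilityMeasure P]
    (N : ℕ) (q : ℝ) (hq : 3 / (2 * (N : ℝ) + 2) ≤ q)
    (f g : ExpSum) (hf : f.WellSeparated (2 * q)) (hg : g.WellSeparated (2 * q))
    (cmin : ℝ) (hcmin : 0 < cmin)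
    (hfc : ∀ y ∈ f.freqs, cmin ≤ ‖f.coeff y‖) (hgc : ∀ y ∈ g.freqs, cmin ≤ ‖g.coeff y‖)
    (σ : ℝ≥0) (X : SampleIdx N → Fin 2 → Ω → ℝ)
    (hX : ∀ k j, HasLaw (X k j) (gaussianReal 0 (σ ^ 2)) P)
    (hindep : iIndepFun (fun p : SampleIdx N × Fin 2 => X p.1 p.2) P)
    (δ : ℝ) (hδ : δ ∈ Set.Ioo (0 : ℝ) 1) :
    1 - Real.exp (-(2 * (N : ℝ) + 1) ^ ((1 + δ) / 2))
        - 2 * Real.exp (-(2 * (N : ℝ) + 1) ^ δ / 8)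
      ≤ P.real {ω |
          errorEstimator N σ δ (sampleVec N f + noiseVec N X ω - sampleVec N g)
              ≤ (4 * (N : ℝ) + 4) / 3 * cmin ^ 2 →
            (∀ y ∈ f.freqs, ∃! y', y' ∈ g.freqs ∧ wrapDist y y' < 3 / (2 * (N : ℝ) + 2)) ∧
            (∀ y' ∈ g.freqs, ∃! y, y ∈ f.freqs ∧ wrapDist y y' < 3 / (2 * (N : ℝ) + 2)) ∧
            ∀ n : ℝ → ℝ,
              (∀ y ∈ f.freqs, n y ∈ g.freqs ∧ wrapDist y (n y) < 3 / (2 * (N : ℝ) + 2)) →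
              ∑ y ∈ f.freqs,
                  (((N : ℝ) + 1) / 3 * ‖f.coeff y - g.coeff (n y)‖ ^ 2
                    + 2 * Real.pi ^ 2 * ((N : ℝ) + 1) ^ 3 / 3 ^ 5 * wrapDist y (n y) ^ 2
                      * ‖f.coeff y + g.coeff (n y)‖ ^ 2)
                ≤ errorEstimator N σ δ
                    (sampleVec N f + noiseVec N X ω - sampleVec N g)} := by

  rcases le_or_gt N 2 with hN | hN
  · exact (prob_bound_nonpos hN hδ).trans measureReal_nonneg
  refine (prob_norm_sq_le_errorEstimator P N (sampleVec N f - sampleVec N g) σ X hX hindep δ).trans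
    (measureReal_mono fun ω hω => ?_)
  rw [Set.mem_ofPred_eq, sub_add_eq_add_sub] at hω
  intro hE
  obtain ⟨h1, h2, h3⟩ := ExpSum.matching_of_norm_sq_le N hN.le f g hq hf hg hcmin hfc hgc
    (hω.trans hE)
  exact ⟨h1, h2, fun n hn => (h3 n hn).trans hω⟩
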